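/- Let $p$ be a prime and let $K$ be a perfectoid field of residue characteristic $p$. Let $q\in K^\times$ with $|q|<1$, and fix a compatible system $q,q^{1/p},q^{1/p^2},\dots$ of $p$-power roots of $q$ in $K$; it defines $q^n\in K^\times$ for all $n\in\mathbb Z[1/p]$. For $s_1,s_2\in K^\times$ with $|s_1|\le|s_2|$ let $B(s_1,s_2)=\{|s_1|\le|X|\le|s_2|\}\subset\mathbb G_{m,K}$, and let $K\langle X/s_2,s_1/X\rangle_\infty$ be the $K$-algebra of all series $\sum_{n\in\mathbb Z[1/p]}a_nX^n$, $a_n\in K$, such that $|a_n||s_1|^n\to0$ and $|a_n||s_2|^n\to0$ (along the countable set of all exponents). Choose $r_0,r_1\in K^\times$ with $|qr_0|<|r_1|<|r_0|$ and put $$U_0=B(r_1,r_0),\quad U_1=B(qr_0,r_1),\quad U_{0,1,+}=B(r_1,r_1),\quad U_{0,1,-}=B(qr_0,qr_0),\quad U_{0+}=B(r_0,r_0).$$ (For example, if $q=\pi^3$, $r_0=\pi^{-1}$, $r_1=\pi$, then $U_0=B(\pi,\pi^{-1})$ and $U_1=B(\pi^2,\pi)$.) **Theorem.** (1) On $K$-points,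 $U_0$ and $U_1$ map injectively to the Tate curve $\mathbb G_{m,K}/\langle q\rangle$; their images cover it, and the intersection of these images is the disjoint union of the images of $U_{0,1,+}$ and $U_{0,1,-}$; the images of $U_{0+}$ and $U_{0,1,-}$ agree. (2) Let $\mathcal T_p$ be $\mathbb G_{m,K}/\langle q\rangle$ with the structure sheaf given on this cover by $\mathcal O(B(s_1,s_2))=K\langle X/s_2,s_1/X\rangle_\infty$, and let $H^i(\mathcal T_p,\mathcal O_{\mathcal T_p})$ be the cohomology of the Čech complex of the cover, $$\mathcal O(U_0)\oplus\mathcal O(U_1)\xrightarrow{\ d\ }\mathcal O(U_{0,1,+})\oplus\mathcal O(U_{0,1,-})\to0\to0\to\cdots,$$ $$d(f,g)=\bigl(f|_{U_{0,1,+}}-g|_{U_{0,1,+}},\ \sigma(f|_{U_{0+}})-g|_{U_{0,1,-}}\bigr),$$ where $\sigma:\mathcal O(U_{0+})\to\mathcal O(U_{0,1,-})$ is the gluing map $X\mapsto X/q$, i.e. $\sum a_nX^n\mapsto\sum a_nq^{-n}X^n$. Then, as $K$-vector spaces, $$H^i(\mathcal T_p,\mathcal O_{\mathcal T_p})\cong\begin{cases}K&i=0,1,\\0&i\ge2.\end{cases}$$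 (3) The same holds if every ring $K\langle X/s_2,s_1/X\rangle_\infty$ is replaced by its subring $\bigcup_{i\ge0}K\langle (X/s_2)^{1/p^i},(s_1/X)^{1/p^i}\rangle$ of those series whose exponents lie in $p^{-i}\mathbb Z$ for some $i$. -/

import Mathlib

namespace PerfectoidTate

universe v

set_option linter.unusedSectionVars false

open Filter Topology

/-- A perfectoid field `K` with residue characteristic `p`: complete for a nonarchimedean absolute
value (the instance arguments), with `|p| < 1`, with nondiscrete value group (there are absolute
values arbitrarily close to `1` from above), and such that Frobenius is surjective
on `K° / p K°`. -/
structure IsPerfectoidField (p : ℕ) (K : Type*) [NormedField K] [IsUltrametricDist K]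
    [CompleteSpace K] : Prop where
  norm_p_lt_one : ‖(p : K)‖ < 1
  nondiscrete : ∀ ε : ℝ, 0 < ε → ∃ x : K, 1 < ‖x‖ ∧ ‖x‖ < 1 + ε
  frobenius_surjective : ∀ x : K, ‖x‖ ≤ 1 → ∃ y z : K, ‖y‖ ≤ 1 ∧ ‖z‖ ≤ 1 ∧ x = y ^ p + p * z

/-- `p^{-i} ℤ`, as a subgroup of `ℚ`. -/
def expLevel (p i : ℕ) : AddSubgroup ℚ :=
  AddSubgroup.comap (AddMonoidHom.mulLeft ((p : ℚ) ^ i)) (Int.castAddHom ℚ).range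

theorem mem_expLevel {p i : ℕ} {x : ℚ} :
    x ∈ expLevel p i ↔ ∃ m : ℤ, (m : ℚ) = (p : ℚ) ^ i * x := Iff.rfl

theorem expLevel_mono (p : ℕ) : Monotone (expLevel p) := by
  intro i j hij x hx
  rw [mem_expLevel] at hx ⊢
  obtain ⟨m, hm⟩ := hx
  refine ⟨(p : ℤ) ^ (j - i) * m, ?_⟩
  push_cast
  rw [hm, ← mul_assoc, ← pow_add, Nat.sub_add_cancel hij]

/-- The exponent group `ℤ[1/p] = ⋃ i, p^{-i} ℤ`, as a subgroup of `ℚ`. -/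
def Exps (p : ℕ) : AddSubgroup ℚ where
  carrier := {x | ∃ i, x ∈ expLevel p i}
  zero_mem' := ⟨0, zero_mem _⟩
  add_mem' := by
    rintro x y ⟨i, hi⟩ ⟨j, hj⟩
    exact ⟨max i j, add_mem (expLevel_mono p (le_max_left i j) hi)
      (expLevel_mono p (le_max_right i j) hj)⟩
  neg_mem' := by
    rintro x ⟨i, hi⟩
    exact ⟨i, neg_mem hi⟩

/-- The exponent `1 ∈ ℤ[1/p]`. -/
def Exps.one (p : ℕ) : Exps p := ⟨1, 0, mem_expLevel.2 ⟨1, by simp⟩⟩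

section Series

variable {p : ℕ} {K : Type*} [NormedField K]

/-- The weight `ρ ^ n`, for a radius `ρ` and an exponent `n ∈ ℤ[1/p]`. -/
noncomputable def weight (ρ : ℝ) (n : Exps p) : ℝ := ρ ^ ((n : ℚ) : ℝ)

theorem weight_pos {ρ : ℝ} (hρ : 0 < ρ) (n : Exps p) : 0 < weight ρ n :=
  Real.rpow_pos_of_pos hρ _

theorem weight_add {ρ : ℝ} (hρ : 0 < ρ) (m n : Exps p) :
    weight ρ (m + n) = weight ρ m * weight ρ n := by
  simp [weight, Real.rpow_add hρ]

theorem weight_zero (ρ : ℝ) : weight ρ (0 : Exps p) = 1 := by simp [weight]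

theorem weight_mul {ρ σ : ℝ} (hρ : 0 < ρ) (hσ : 0 < σ) (n : Exps p) :
    weight (ρ * σ) n = weight ρ n * weight σ n :=
  Real.mul_rpow hρ.le hσ.le

theorem weight_le_add {ρ₁ ρ ρ₂ : ℝ} (h₁ : 0 < ρ₁) (h : ρ₁ ≤ ρ) (h' : ρ ≤ ρ₂) (n : Exps p) :
    weight ρ n ≤ weight ρ₁ n + weight ρ₂ n := by
  have hρ := h₁.trans_le h
  have hρ₂ := hρ.trans_le h'
  rcases le_total 0 (((n : ℚ) : ℝ)) with hn | hn
  · have := Real.rpow_le_rpow hρ.le h' hn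
    have h2 := weight_pos h₁ n
    simp only [weight] at *
    linarith
  · have := Real.rpow_le_rpow_of_nonpos h₁ h hn
    have h2 := weight_pos hρ₂ n
    simp only [weight] at *
    linarith

/-- The series `∑ a_n X^n`, `n ∈ ℤ[1/p]`, converges on the circle `|X| = ρ`:
`|a_n| ρ^n → 0` along the (countable) set of all exponents. -/
def Conv (ρ : ℝ) (a : Exps p → K) : Prop :=
  Tendsto (fun n => ‖a n‖ * weight ρ n) cofinite (𝓝 0)

theorem Conv.mono {ρ₁ ρ ρ₂ : ℝ} (h₁ : 0 < ρ₁) (h : ρ₁ ≤ ρ) (h' : ρ ≤ ρ₂) {a : Exps p → K}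
    (ha₁ : Conv ρ₁ a) (ha₂ : Conv ρ₂ a) : Conv ρ a := by
  have := ha₁.add ha₂
  rw [add_zero] at this
  refine squeeze_zero
    (fun n => mul_nonneg (norm_nonneg _) (weight_pos (h₁.trans_le h) n).le) (fun n => ?_) this
  rw [← mul_add]
  exact mul_le_mul_of_nonneg_left (weight_le_add h₁ h h' n) (norm_nonneg _)

theorem Conv.add {ρ : ℝ} (hρ : 0 < ρ) {a b : Exps p → K} (ha : Conv ρ a) (hb : Conv ρ b) :
    Conv ρ (a + b) := by
  have := Tendsto.add ha hb
  rw [add_zero] at this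
  refine squeeze_zero (fun n => mul_nonneg (norm_nonneg _) (weight_pos hρ n).le) (fun n => ?_) this
  rw [← add_mul]
  exact mul_le_mul_of_nonneg_right (norm_add_le _ _) (weight_pos hρ n).le

theorem Conv.zero (ρ : ℝ) : Conv ρ (0 : Exps p → K) := by
  simpa [Conv] using tendsto_const_nhds

theorem Conv.smul {ρ : ℝ} (c : K) {a : Exps p → K} (ha : Conv ρ a) : Conv ρ (c • a) := by
  have := Tendsto.const_mul ‖c‖ ha
  rw [mul_zero] at this
  refine this.congr fun n => ?_
  simp [mul_assoc]

open Classical in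
theorem Conv.single (ρ : ℝ) (n : Exps p) (c : K) : Conv ρ (Pi.single n c : Exps p → K) := by
  refine tendsto_const_nhds.congr' ?_
  have : ({n}ᶜ : Set (Exps p)) ∈ cofinite := (Set.finite_singleton n).compl_mem_cofinite
  filter_upwards [this] with m hm
  simp [Pi.single_eq_of_ne (show m ≠ n from hm)]

/-- The product of series, `(∑ a_m X^m)(∑ b_m X^m) = ∑_n (∑_m a_m b_{n-m}) X^n`. -/
noncomputable def cauchyProd (a b : Exps p → K) (n : Exps p) : K := ∑' m, a m * b (n - m)

theorem tendsto_prod {α β : Type*} {u : α → ℝ} {v : β → ℝ} (hu : Tendsto u cofinite (𝓝 0))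
    (hv : Tendsto v cofinite (𝓝 0)) (hu0 : ∀ x, 0 ≤ u x) (hv0 : ∀ x, 0 ≤ v x) :
    Tendsto (fun x : α × β => u x.1 * v x.2) cofinite (𝓝 0) := by
  obtain ⟨A, hA⟩ := hu.bddAbove_range_of_cofinite
  obtain ⟨B, hB⟩ := hv.bddAbove_range_of_cofinite
  have hA' : ∀ x, u x ≤ |A| + 1 := fun x => by
    have := hA ⟨x, rfl⟩
    linarith [le_abs_self A]
  have hB' : ∀ x, v x ≤ |B| + 1 := fun x => by
    have := hB ⟨x, rfl⟩
    linarith [le_abs_self B]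
  have hApos : 0 < |A| + 1 := by positivity
  have hBpos : 0 < |B| + 1 := by positivity
  rw [tendsto_order]
  refine ⟨fun c hc => .of_forall fun x => hc.trans_le (mul_nonneg (hu0 _) (hv0 _)), ?_⟩
  intro ε hε
  have h1 := hu.eventually (gt_mem_nhds (div_pos hε hBpos))
  have h2 := hv.eventually (gt_mem_nhds (div_pos hε hApos))
  rw [eventually_cofinite] at h1 h2 ⊢
  refine (h1.prod h2).subset ?_
  rintro ⟨x, y⟩ hxy
  simp only [Set.mem_ofPred_eq, not_lt, Set.mem_prod] at hxy ⊢
  constructor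
  · rw [div_le_iff₀ hBpos]
    exact hxy.trans (mul_le_mul_of_nonneg_left (hB' y) (hu0 x))
  · rw [div_le_iff₀ hApos]
    refine hxy.trans ?_
    rw [mul_comm]
    exact mul_le_mul_of_nonneg_left (hA' x) (hv0 y)

theorem Conv.bddAbove {ρ : ℝ} {a : Exps p → K} (ha : Conv ρ a) :
    ∃ C : ℝ, 0 < C ∧ ∀ n, ‖a n‖ * weight ρ n ≤ C := by
  obtain ⟨A, hA⟩ := Tendsto.bddAbove_range_of_cofinite ha
  refine ⟨|A| + 1, by positivity, fun n => ?_⟩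
  have := hA ⟨n, rfl⟩
  linarith [le_abs_self A]

theorem Conv.tendsto_pair {ρ : ℝ} (hρ : 0 < ρ) {a b : Exps p → K} (ha : Conv ρ a)
    (hb : Conv ρ b) :
    Tendsto (fun x : Exps p × Exps p => ‖a x.1‖ * ‖b x.2‖ * weight ρ (x.1 + x.2))
      cofinite (𝓝 0) := by
  refine (tendsto_prod ha hb (fun n => mul_nonneg (norm_nonneg _) (weight_pos hρ n).le)
    (fun n => mul_nonneg (norm_nonneg _) (weight_pos hρ n).le)).congr fun x => ?_
  rw [weight_add hρ]
  ring

variable [IsUltrametricDist K]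

theorem Conv.cauchyProd {ρ : ℝ} (hρ : 0 < ρ) {a b : Exps p → K} (ha : Conv ρ a)
    (hb : Conv ρ b) : Conv ρ (cauchyProd a b) := by
  have h := ha.tendsto_pair hρ hb
  have hnn : ∀ n, 0 ≤ ‖PerfectoidTate.cauchyProd a b n‖ * weight ρ n :=
    fun n => mul_nonneg (norm_nonneg _) (weight_pos hρ n).le
  rw [Conv, tendsto_order]
  refine ⟨fun c hc => .of_forall fun n => hc.trans_le (hnn n), fun ε hε => ?_⟩
  have h2 := h.eventually (gt_mem_nhds (half_pos hε))
  rw [eventually_cofinite] at h2 ⊢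
  refine (h2.image (fun x => x.1 + x.2)).subset ?_
  intro n hn
  by_contra hcon
  apply hn
  have hw := weight_pos hρ n
  have : ‖PerfectoidTate.cauchyProd a b n‖ ≤ ε / 2 / weight ρ n := by
    refine IsUltrametricDist.norm_tsum_le_of_forall_le_of_nonneg (by positivity) fun m => ?_
    rw [le_div_iff₀ hw, norm_mul]
    by_contra hlt
    refine hcon ⟨(m, n - m), ?_, by simp⟩
    simp only [Set.mem_ofPred_eq, not_lt, add_sub_cancel]
    exact (not_le.1 hlt).le
  rw [le_div_iff₀ hw] at this
  linarith

variable [CompleteSpace K]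

theorem summable_of_weight {α : Type*} {F : α → K} {w : ℝ} (hw : 0 < w)
    (h : Tendsto (fun x => ‖F x‖ * w) cofinite (𝓝 0)) : Summable F := by
  refine NonarchimedeanAddGroup.summable_of_tendsto_cofinite_zero ?_
  rw [tendsto_zero_iff_norm_tendsto_zero]
  have := h.mul_const w⁻¹
  rw [zero_mul] at this
  refine this.congr fun x => ?_
  field_simp

theorem Conv.summable {ρ : ℝ} (hρ : 0 < ρ) {a b : Exps p → K} (ha : Conv ρ a)
    (hb : Conv ρ b) (n : Exps p) : Summable fun m => a m * b (n - m) := by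
  have h := ha.tendsto_pair hρ hb
  refine summable_of_weight (weight_pos hρ n) ?_
  have hinj : Function.Injective fun m : Exps p => (m, n - m) :=
    fun x y hxy => (Prod.ext_iff.1 hxy).1
  refine (h.comp hinj.tendsto_cofinite).congr fun m => ?_
  simp

theorem cauchyProd_comm (a b : Exps p → K) : cauchyProd a b = cauchyProd b a := by
  funext n
  unfold cauchyProd
  rw [← (Equiv.subLeft n).tsum_eq]
  refine tsum_congr fun m => ?_
  simp [mul_comm]

theorem Conv.cauchyProd_add {ρ : ℝ} (hρ : 0 < ρ) {a b c : Exps p → K} (ha : Conv ρ a)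
    (hb : Conv ρ b) (hc : Conv ρ c) :
    PerfectoidTate.cauchyProd a (b + c) =
      PerfectoidTate.cauchyProd a b + PerfectoidTate.cauchyProd a c := by
  funext n
  rw [Pi.add_apply]
  unfold PerfectoidTate.cauchyProd
  rw [← (ha.summable hρ hb n).tsum_add (ha.summable hρ hc n)]
  exact tsum_congr fun m => by simp [mul_add]

theorem cauchyProd_smul (r : K) (a b : Exps p → K) :
    cauchyProd (r • a) b = r • cauchyProd a b := by
  funext n
  simp only [Pi.smul_apply, cauchyProd, smul_eq_mul]
  rw [← tsum_mul_left]
  exact tsum_congr fun m => by rw [mul_assoc]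

open Classical in
theorem single_cauchyProd (a : Exps p → K) : cauchyProd (Pi.single 0 1) a = a := by
  funext n
  unfold cauchyProd
  rw [tsum_eq_single 0 fun m hm => by simp [Pi.single_eq_of_ne hm]]
  simp

theorem Conv.cauchyProd_assoc {ρ : ℝ} (hρ : 0 < ρ) {a b c : Exps p → K} (ha : Conv ρ a)
    (hb : Conv ρ b) (hc : Conv ρ c) :
    PerfectoidTate.cauchyProd (PerfectoidTate.cauchyProd a b) c =
      PerfectoidTate.cauchyProd a (PerfectoidTate.cauchyProd b c) := by
  funext n
  have hsum : Summable fun x : Exps p × Exps p => a x.2 * b (x.1 - x.2) * c (n - x.1) := by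
    obtain ⟨C, hC, hcC⟩ := hc.bddAbove
    refine summable_of_weight (weight_pos hρ n) ?_
    have h := (ha.tendsto_pair hρ hb).mul_const C
    rw [zero_mul] at h
    have hinj : Function.Injective fun x : Exps p × Exps p => (x.2, x.1 - x.2) := by
      rintro ⟨x, y⟩ ⟨x', y'⟩ hxy
      simp only [Prod.mk.injEq] at hxy ⊢
      obtain ⟨h1, h2⟩ := hxy
      subst h1
      exact ⟨sub_left_inj.1 h2, rfl⟩
    refine squeeze_zero (fun x => mul_nonneg (norm_nonneg _) (weight_pos hρ n).le) (fun x => ?_)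
      (h.comp hinj.tendsto_cofinite)
    have hn : weight ρ n = weight ρ (x.2 + (x.1 - x.2)) * weight ρ (n - x.1) := by
      rw [← weight_add hρ]
      congr 1
      abel
    simp only [Function.comp_apply, norm_mul]
    rw [hn]
    calc _ = (‖a x.2‖ * ‖b (x.1 - x.2)‖ * weight ρ (x.2 + (x.1 - x.2))) *
          (‖c (n - x.1)‖ * weight ρ (n - x.1)) := by ring
      _ ≤ _ := mul_le_mul_of_nonneg_left (hcC _)
          (mul_nonneg (by positivity) (weight_pos hρ _).le)
  unfold PerfectoidTate.cauchyProd
  have e1 : ∀ m, (∑' l, a l * b (m - l)) * c (n - m) =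
      ∑' l, a l * b (m - l) * c (n - m) := fun m => tsum_mul_right.symm
  have e2 : ∀ l, a l * ∑' k, b k * c (n - l - k) =
      ∑' m, a l * b (m - l) * c (n - m) := fun l => by
    rw [← (Equiv.subRight l).tsum_eq, ← tsum_mul_left]
    refine tsum_congr fun m => ?_
    simp [mul_assoc]
  have e3 : ∑' l, ∑' m, a l * b (m - l) * c (n - m) =
      ∑' m, ∑' l, a l * b (m - l) * c (n - m) :=
    Summable.tsum_comm (f := fun m l => a l * b (m - l) * c (n - m)) hsum
  rw [tsum_congr e1, tsum_congr e2, e3]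

end Series

section Annulus

variable (p : ℕ) {K : Type*} [NormedField K]

theorem norm_units_pos (r : Kˣ) : 0 < ‖(r : K)‖ := norm_pos_iff.2 r.ne_zero

/-- The series `∑ a_n X^n`, `n ∈ ℤ[1/p]`, that converge on the annulus with inner radius `|r₁|` and
outer radius `|r₂|`. -/
def convSubmodule (r₁ r₂ : Kˣ) : Submodule K (Exps p → K) where
  carrier := {a | Conv ‖(r₁ : K)‖ a ∧ Conv ‖(r₂ : K)‖ a}
  zero_mem' := ⟨Conv.zero _, Conv.zero _⟩
  add_mem' ha hb := ⟨ha.1.add (norm_units_pos r₁) hb.1, ha.2.add (norm_units_pos r₂) hb.2⟩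
  smul_mem' c _ ha := ⟨ha.1.smul c, ha.2.smul c⟩

/-- The complete ring `K⟨X/r₂, r₁/X⟩_∞` of perfectoid functions on the annulus
`B(r₁, r₂) = {|r₁| ≤ |X| ≤ |r₂|}` : the series `∑ a_n X^n` over all `n ∈ ℤ[1/p]` such that
`|a_n| |r₁|^n → 0` and `|a_n| |r₂|^n → 0`. For `|r₁| ≤ |r₂|` this is the same as
`|a_n| |r₂|^n → 0` over `n > 0` and `|a_n| |r₁|^n → 0` over `n < 0`. -/
def AnnulusRing (r₁ r₂ : Kˣ) : Type _ := convSubmodule p r₁ r₂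

namespace AnnulusRing

variable {p}
variable {r₁ r₂ s₁ s₂ : Kˣ}

instance : AddCommGroup (AnnulusRing p r₁ r₂) :=
  inferInstanceAs (AddCommGroup (convSubmodule p r₁ r₂))

instance : Module K (AnnulusRing p r₁ r₂) :=
  inferInstanceAs (Module K (convSubmodule p r₁ r₂))

/-- The coefficients `(a_n)` of `∑ a_n X^n`. -/
def coeff : AnnulusRing p r₁ r₂ →ₗ[K] (Exps p → K) := (convSubmodule p r₁ r₂).subtype

theorem coeff_injective : Function.Injective (coeff (p := p) (r₁ := r₁) (r₂ := r₂)) :=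
  Subtype.val_injective

@[ext]
theorem ext {f g : AnnulusRing p r₁ r₂} (h : coeff f = coeff g) : f = g := coeff_injective h

theorem conv₁ (f : AnnulusRing p r₁ r₂) : Conv ‖(r₁ : K)‖ (coeff f) := f.2.1

theorem conv₂ (f : AnnulusRing p r₁ r₂) : Conv ‖(r₂ : K)‖ (coeff f) := f.2.2

/-- The series with given coefficients. -/
def mk (a : Exps p → K) (h₁ : Conv ‖(r₁ : K)‖ a) (h₂ : Conv ‖(r₂ : K)‖ a) :
    AnnulusRing p r₁ r₂ := ⟨a, h₁, h₂⟩

@[simp]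
theorem coeff_mk (a : Exps p → K) (h₁ : Conv ‖(r₁ : K)‖ a) (h₂ : Conv ‖(r₂ : K)‖ a) :
    coeff (mk a h₁ h₂ : AnnulusRing p r₁ r₂) = a := rfl

variable [IsUltrametricDist K]

noncomputable instance : Mul (AnnulusRing p r₁ r₂) where
  mul f g := mk (cauchyProd (coeff f) (coeff g))
    (f.conv₁.cauchyProd (norm_units_pos r₁) g.conv₁)
    (f.conv₂.cauchyProd (norm_units_pos r₂) g.conv₂)

open Classical in
noncomputable instance : One (AnnulusRing p r₁ r₂) where
  one := mk (Pi.single 0 1) (Conv.single _ _ _) (Conv.single _ _ _)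

theorem coeff_mul (f g : AnnulusRing p r₁ r₂) :
    coeff (f * g) = cauchyProd (coeff f) (coeff g) := rfl

open Classical in
theorem coeff_one : coeff (1 : AnnulusRing p r₁ r₂) = Pi.single 0 1 := rfl

variable [CompleteSpace K]

protected theorem mul_comm (f g : AnnulusRing p r₁ r₂) : f * g = g * f :=
  ext (cauchyProd_comm _ _)

protected theorem mul_add (f g h : AnnulusRing p r₁ r₂) : f * (g + h) = f * g + f * h :=
  ext (by simpa only [coeff_mul, map_add] using
    f.conv₁.cauchyProd_add (norm_units_pos r₁) g.conv₁ h.conv₁)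

protected theorem one_mul (f : AnnulusRing p r₁ r₂) : 1 * f = f :=
  ext (by rw [coeff_mul, coeff_one, single_cauchyProd])

protected theorem smul_mul (r : K) (f g : AnnulusRing p r₁ r₂) : (r • f) * g = r • (f * g) :=
  ext (by simp only [coeff_mul, map_smul, cauchyProd_smul])

noncomputable instance : CommRing (AnnulusRing p r₁ r₂) where
  __ := (inferInstance : AddCommGroup (AnnulusRing p r₁ r₂))
  mul_assoc f g h := ext (f.conv₁.cauchyProd_assoc (norm_units_pos r₁) g.conv₁ h.conv₁)
  mul_comm := AnnulusRing.mul_comm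
  one_mul := AnnulusRing.one_mul
  mul_one f := by rw [AnnulusRing.mul_comm, AnnulusRing.one_mul]
  left_distrib := AnnulusRing.mul_add
  right_distrib f g h := by
    rw [AnnulusRing.mul_comm, AnnulusRing.mul_add, AnnulusRing.mul_comm h f,
      AnnulusRing.mul_comm h g]
  zero_mul f := ext (by
    rw [coeff_mul, map_zero]
    funext n
    simp [cauchyProd])
  mul_zero f := ext (by
    rw [coeff_mul, map_zero]
    funext n
    simp [cauchyProd])

noncomputable instance : Algebra K (AnnulusRing p r₁ r₂) :=
  Algebra.ofModule AnnulusRing.smul_mul fun r f g => by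
    rw [AnnulusRing.mul_comm, AnnulusRing.smul_mul, AnnulusRing.mul_comm]

/-- Restriction `O(B(r₁, r₂)) → O(B(s₁, s₂))` for `|r₁| ≤ |s₁| ≤ |r₂|` and `|r₁| ≤ |s₂| ≤ |r₂|`,
`∑ a_n X^n ↦ ∑ a_n X^n`. -/
noncomputable def res (h₁ : ‖(r₁ : K)‖ ≤ ‖(s₁ : K)‖) (h₁' : ‖(s₁ : K)‖ ≤ ‖(r₂ : K)‖)
    (h₂ : ‖(r₁ : K)‖ ≤ ‖(s₂ : K)‖) (h₂' : ‖(s₂ : K)‖ ≤ ‖(r₂ : K)‖) :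
    AnnulusRing p r₁ r₂ →ₐ[K] AnnulusRing p s₁ s₂ :=
  AlgHom.ofLinearMap
    { toFun := fun f => mk (coeff f) (f.conv₁.mono (norm_units_pos r₁) h₁ h₁' f.conv₂)
        (f.conv₁.mono (norm_units_pos r₁) h₂ h₂' f.conv₂)
      map_add' := fun _ _ => rfl
      map_smul' := fun _ _ => rfl }
    rfl (fun _ _ => rfl)

@[simp]
theorem coeff_res (h₁ : ‖(r₁ : K)‖ ≤ ‖(s₁ : K)‖) (h₁' : ‖(s₁ : K)‖ ≤ ‖(r₂ : K)‖)
    (h₂ : ‖(r₁ : K)‖ ≤ ‖(s₂ : K)‖) (h₂' : ‖(s₂ : K)‖ ≤ ‖(r₂ : K)‖) (f : AnnulusRing p r₁ r₂) :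
    coeff (res h₁ h₁' h₂ h₂' f) = coeff f := rfl

/-- The subalgebra `K⟨(X/r₂)^{1/p^i}, (r₁/X)^{1/p^i}⟩` of series with exponents in `p^{-i} ℤ`. -/
noncomputable def level (r₁ r₂ : Kˣ) (i : ℕ) : Subalgebra K (AnnulusRing p r₁ r₂) where
  carrier := {f | ∀ n, coeff f n ≠ 0 → (n : ℚ) ∈ expLevel p i}
  zero_mem' := fun n hn => (hn (by simp)).elim
  add_mem' := by
    intro f g hf hg n hn
    by_contra hc
    apply hn
    rw [map_add, Pi.add_apply, not_imp_comm.1 (hf n) hc, not_imp_comm.1 (hg n) hc, add_zero]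
  mul_mem' := by
    intro f g hf hg n hn
    by_contra hc
    apply hn
    rw [coeff_mul, cauchyProd]
    have : ∀ m, coeff f m * coeff g (n - m) = 0 := fun m => by
      by_contra hm
      have h := add_mem (hf m (left_ne_zero_of_mul hm)) (hg _ (right_ne_zero_of_mul hm))
      exact hc (by simpa using h)
    simp [this]
  algebraMap_mem' := by
    classical
    intro r n hn
    rw [Algebra.algebraMap_eq_smul_one, map_smul, coeff_one] at hn
    have h0 : n = 0 := by
      by_contra h
      exact hn (by simp [Pi.single_eq_of_ne h])
    subst h0
    exact zero_mem _

theorem level_mono (r₁ r₂ : Kˣ) : Monotone (level (p := p) r₁ r₂) :=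
  fun _ _ hij _ hf n hn => expLevel_mono p hij (hf n hn)

/-- The increasing union `⋃ i, K⟨(X/r₂)^{1/p^i}, (r₁/X)^{1/p^i}⟩`. -/
noncomputable def union (p : ℕ) (r₁ r₂ : Kˣ) : Subalgebra K (AnnulusRing p r₁ r₂) where
  carrier := {f | ∃ i, f ∈ level r₁ r₂ i}
  add_mem' := by
    rintro f g ⟨i, hi⟩ ⟨j, hj⟩
    exact ⟨max i j, add_mem (level_mono _ _ (le_max_left i j) hi)
      (level_mono _ _ (le_max_right i j) hj)⟩
  mul_mem' := by
    rintro f g ⟨i, hi⟩ ⟨j, hj⟩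
    exact ⟨max i j, mul_mem (level_mono _ _ (le_max_left i j) hi)
      (level_mono _ _ (le_max_right i j) hj)⟩
  algebraMap_mem' r := ⟨0, Subalgebra.algebraMap_mem _ r⟩

end AnnulusRing

end Annulus

section Tate

variable {K : Type*} [NormedField K]

/-- A choice of fractional powers `q^n`, `n ∈ ℤ[1/p]`, of `q` in `K`, that is, of a compatible system
`q, q^{1/p}, q^{1/p^2}, …` of `p`-power roots of `q`. -/
structure PowerSystem (p : ℕ) (q : Kˣ) where
  pow : Multiplicative (Exps p) →* Kˣ
  pow_one : pow (Multiplicative.ofAdd (Exps.one p)) = q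

theorem PowerSystem.norm_pow {p : ℕ} [Fact p.Prime] {q : Kˣ} (χ : PowerSystem p q) (n : Exps p) :
    ‖(χ.pow (Multiplicative.ofAdd n) : K)‖ = weight ‖(q : K)‖ n := by
  obtain ⟨i, hi⟩ := n.2
  obtain ⟨m, hm⟩ := mem_expLevel.1 hi
  have hp : (p ^ i : ℕ) ≠ 0 := pow_ne_zero _ (Fact.out : p.Prime).ne_zero
  have h1 : (p ^ i : ℕ) • n = m • Exps.one p := by
    ext
    simp only [Exps.one, AddSubgroup.coe_nsmul, AddSubgroup.coe_zsmul, nsmul_eq_mul,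
      zsmul_eq_mul, mul_one, hm]
    push_cast
    rfl
  have h2 : χ.pow (Multiplicative.ofAdd n) ^ (p ^ i : ℕ) = q ^ m := by
    rw [← map_pow, ← ofAdd_nsmul, h1, ofAdd_zsmul, map_zpow, χ.pow_one]
  have h3 : ‖(χ.pow (Multiplicative.ofAdd n) : K)‖ ^ (p ^ i : ℕ) = ‖(q : K)‖ ^ m := by
    rw [← _root_.norm_pow, ← norm_zpow, ← Units.val_pow_eq_pow_val, h2, Units.val_zpow_eq_zpow_val]
  have hq := norm_units_pos q
  refine (pow_left_inj₀ (norm_nonneg _) (weight_pos hq n).le hp).1 ?_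
  rw [h3, weight, ← Real.rpow_natCast, ← Real.rpow_mul hq.le, ← Real.rpow_intCast]
  congr 1
  have : ((m : ℚ) : ℝ) = (((p : ℚ) ^ i * (n : ℚ) : ℚ) : ℝ) := by rw [hm]
  push_cast at this ⊢
  rw [this, mul_comm]

variable [IsUltrametricDist K] [CompleteSpace K]

theorem PowerSystem.conv_twist {p : ℕ} [Fact p.Prime] {q : Kˣ} (χ : PowerSystem p q) {r : Kˣ}
    {a : Exps p → K} (ha : Conv ‖(r : K)‖ a) :
    Conv ‖((q * r : Kˣ) : K)‖ fun n => (χ.pow (Multiplicative.ofAdd (-n)) : K) * a n := by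
  refine Tendsto.congr (fun n => ?_) ha
  rw [norm_mul, χ.norm_pow, Units.val_mul, norm_mul,
    weight_mul (norm_units_pos q) (norm_units_pos r)]
  have h := weight_add (norm_units_pos q) (-n) n
  rw [neg_add_cancel, weight_zero] at h
  calc _ = 1 * (‖a n‖ * weight ‖(r : K)‖ n) := (one_mul _).symm
    _ = _ := by
      rw [h]
      ring

/-- The gluing isomorphism of rings `O(B(r₁, r₂)) → O(B(q r₁, q r₂))`, `X ↦ X / q`, that is
`∑ a_n X^n ↦ ∑ a_n q^{-n} X^n`, which is pull-back under multiplication by `q⁻¹` from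
`B(q r₁, q r₂)` to `B(r₁, r₂)`. -/
noncomputable def glue {p : ℕ} [Fact p.Prime] {q : Kˣ} (χ : PowerSystem p q) (r₁ r₂ : Kˣ) :
    AnnulusRing p r₁ r₂ →ₐ[K] AnnulusRing p (q * r₁) (q * r₂) :=
  AlgHom.ofLinearMap
    { toFun := fun f => AnnulusRing.mk
        (fun n => (χ.pow (Multiplicative.ofAdd (-n)) : K) * AnnulusRing.coeff f n)
        (χ.conv_twist f.conv₁) (χ.conv_twist f.conv₂)
      map_add' := fun f g => AnnulusRing.ext (by
        funext n
        simp [mul_add])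
      map_smul' := fun c f => AnnulusRing.ext (by
        funext n
        simp [mul_left_comm]) }
    (AnnulusRing.ext (by
      classical
      funext n
      simp only [LinearMap.coe_mk, AddHom.coe_mk, AnnulusRing.coeff_mk, AnnulusRing.coeff_one]
      by_cases hn : n = 0
      · subst hn
        simp
      · simp [Pi.single_eq_of_ne hn]))
    (fun f g => AnnulusRing.ext (by
      funext n
      simp only [LinearMap.coe_mk, AddHom.coe_mk, AnnulusRing.coeff_mk, AnnulusRing.coeff_mul,
        cauchyProd]
      rw [← tsum_mul_left]
      refine tsum_congr fun m => ?_
      have : -n = -m + -(n - m) := by abel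
      rw [this, ofAdd_add, map_mul, Units.val_mul]
      ring))

@[simp]
theorem coeff_glue {p : ℕ} [Fact p.Prime] {q : Kˣ} (χ : PowerSystem p q) (r₁ r₂ : Kˣ)
    (f : AnnulusRing p r₁ r₂) (n : Exps p) :
    AnnulusRing.coeff (glue χ r₁ r₂ f) n =
      (χ.pow (Multiplicative.ofAdd (-n)) : K) * AnnulusRing.coeff f n := rfl

/-- The Tate curve `𝔾_{m,K} / ⟨q⟩` (its `K`-points). -/
abbrev TateCurve (q : Kˣ) : Type _ := Kˣ ⧸ Subgroup.zpowers q

/-- The annulus `B(r₁, r₂) = {|r₁| ≤ |x| ≤ |r₂|}` in `𝔾_{m,K}`. -/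
def annulus (r₁ r₂ : Kˣ) : Set Kˣ := {x | ‖(r₁ : K)‖ ≤ ‖(x : K)‖ ∧ ‖(x : K)‖ ≤ ‖(r₂ : K)‖}

/-- The image of a subset of `𝔾_{m,K}` in the Tate curve. -/
def image (q : Kˣ) (S : Set Kˣ) : Set (TateCurve q) := (fun x : Kˣ => (x : TateCurve q)) '' S

/-- The radii of a standard admissible cover of `𝔾_{m,K} / ⟨q⟩` by two annuli,
`U₀ = B(r₁, r₀)` and `U₁ = B(q r₀, r₁)`, where `|q r₀| < |r₁| < |r₀|`. For `q = π ^ 3`, `r₀ = π⁻¹` and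
`r₁ = π` these are `B(π, π⁻¹)` and `B(π², π)`, with `B(π², π²)` glued to `B(π⁻¹, π⁻¹)` by
multiplication by `π⁻³`. -/
structure StandardCover (q : Kˣ) where
  r₀ : Kˣ
  r₁ : Kˣ
  inner_lt : ‖((q * r₀ : Kˣ) : K)‖ < ‖(r₁ : K)‖
  lt_outer : ‖(r₁ : K)‖ < ‖(r₀ : K)‖

namespace StandardCover

variable {q : Kˣ} (U : StandardCover q)

variable (p : ℕ)

/-- `O(U₀) = K⟨X/r₀, r₁/X⟩_∞`. -/
abbrev O₀ := AnnulusRing p U.r₁ U.r₀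

/-- `O(U₁) = K⟨X/r₁, q r₀/X⟩_∞`. -/
abbrev O₁ := AnnulusRing p (q * U.r₀) U.r₁

/-- `O(U_{0,1,+})`, for the circle `B(r₁, r₁)`, the inner boundary of `U₀` and outer boundary
of `U₁`. -/
abbrev Oplus := AnnulusRing p U.r₁ U.r₁

/-- `O(U_{0,1,-})`, for the circle `B(q r₀, q r₀)`, the inner boundary of `U₁`, which is glued to the
outer boundary `U_{0+} = B(r₀, r₀)` of `U₀`. -/
abbrev Ominus := AnnulusRing p (q * U.r₀) (q * U.r₀)

/-- Restriction `O(U₀) → O(U_{0,1,+})`. -/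
noncomputable def res₀plus : U.O₀ p →ₐ[K] U.Oplus p :=
  AnnulusRing.res le_rfl U.lt_outer.le le_rfl U.lt_outer.le

/-- Restriction `O(U₁) → O(U_{0,1,+})`. -/
noncomputable def res₁plus : U.O₁ p →ₐ[K] U.Oplus p :=
  AnnulusRing.res U.inner_lt.le le_rfl U.inner_lt.le le_rfl

/-- Restriction `O(U₁) → O(U_{0,1,-})`. -/
noncomputable def res₁minus : U.O₁ p →ₐ[K] U.Ominus p :=
  AnnulusRing.res le_rfl U.inner_lt.le le_rfl U.inner_lt.le

variable {p} [Fact p.Prime]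

/-- Restriction `O(U₀) → O(U_{0+})` followed by the gluing `O(U_{0+}) → O(U_{0,1,-})`. -/
noncomputable def res₀minus (χ : PowerSystem p q) : U.O₀ p →ₐ[K] U.Ominus p :=
  (glue χ U.r₀ U.r₀).comp (AnnulusRing.res U.lt_outer.le le_rfl U.lt_outer.le le_rfl)

end StandardCover

/-- The difference `(f, g) ↦ (f|₊ - g|₊, f|₋ - g|₋)` of the restrictions of sections over two open
sets to the two components of their intersection. -/
def cechDiff {A₀ A₁ Bp Bm : Type*} [CommRing A₀] [CommRing A₁] [CommRing Bp] [CommRing Bm]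
    [Algebra K A₀] [Algebra K A₁] [Algebra K Bp] [Algebra K Bm]
    (f₀p : A₀ →ₐ[K] Bp) (f₁p : A₁ →ₐ[K] Bp) (f₀m : A₀ →ₐ[K] Bm) (f₁m : A₁ →ₐ[K] Bm) :
    (A₀ × A₁) →ₗ[K] (Bp × Bm) :=
  LinearMap.prod
    (f₀p.toLinearMap ∘ₗ LinearMap.fst K A₀ A₁ - f₁p.toLinearMap ∘ₗ LinearMap.snd K A₀ A₁)
    (f₀m.toLinearMap ∘ₗ LinearMap.fst K A₀ A₁ - f₁m.toLinearMap ∘ₗ LinearMap.snd K A₀ A₁)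

/-- The cochain complex `A → B → 0 → 0 → ⋯` with `A` in degree `0`. -/
noncomputable def twoTerm {A B : Type v} [AddCommGroup A] [AddCommGroup B] [Module K A] [Module K B]
    (d : A →ₗ[K] B) : CochainComplex (ModuleCat K) ℕ :=
  HomologicalComplex.double (ModuleCat.ofHom d) (i₀ := 0) (i₁ := 1) rfl

namespace StandardCover

variable {q : Kˣ} (U : StandardCover q) {p : ℕ} [Fact p.Prime]

/-- The Čech complex `O(U₀) ⊕ O(U₁) → O(U_{0,1,+}) ⊕ O(U_{0,1,-}) → 0` for the complete rings. -/
noncomputable def cech (χ : PowerSystem p q) : CochainComplex (ModuleCat K) ℕ :=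
  twoTerm (cechDiff (U.res₀plus p) (U.res₁plus p) (U.res₀minus χ) (U.res₁minus p))

theorem glue_mem_union (χ : PowerSystem p q) {r₁ r₂ : Kˣ} {f : AnnulusRing p r₁ r₂}
    (hf : f ∈ AnnulusRing.union p r₁ r₂) :
    glue χ r₁ r₂ f ∈ AnnulusRing.union p (q * r₁) (q * r₂) := by
  obtain ⟨i, hi⟩ := hf
  exact ⟨i, fun n hn => hi n (right_ne_zero_of_mul hn)⟩

theorem res₀plus_mem {f : U.O₀ p} (hf : f ∈ AnnulusRing.union p U.r₁ U.r₀) :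
    U.res₀plus p f ∈ AnnulusRing.union p U.r₁ U.r₁ := hf

theorem res₁plus_mem {f : U.O₁ p} (hf : f ∈ AnnulusRing.union p (q * U.r₀) U.r₁) :
    U.res₁plus p f ∈ AnnulusRing.union p U.r₁ U.r₁ := hf

theorem res₁minus_mem {f : U.O₁ p} (hf : f ∈ AnnulusRing.union p (q * U.r₀) U.r₁) :
    U.res₁minus p f ∈ AnnulusRing.union p (q * U.r₀) (q * U.r₀) := hf

theorem res₀minus_mem (χ : PowerSystem p q) {f : U.O₀ p}
    (hf : f ∈ AnnulusRing.union p U.r₁ U.r₀) :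
    U.res₀minus χ f ∈ AnnulusRing.union p (q * U.r₀) (q * U.r₀) :=
  glue_mem_union χ (f := AnnulusRing.res U.lt_outer.le le_rfl U.lt_outer.le le_rfl f) hf

/-- The Čech complex `O(U₀) ⊕ O(U₁) → O(U_{0,1,+}) ⊕ O(U_{0,1,-}) → 0` for the unions
`⋃ i, K⟨(X/r₂)^{1/p^i}, (r₁/X)^{1/p^i}⟩`. -/
noncomputable def cechUnion (χ : PowerSystem p q) : CochainComplex (ModuleCat K) ℕ :=
  twoTerm (cechDiff
    (((U.res₀plus p).comp (AnnulusRing.union p U.r₁ U.r₀).val).codRestrict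
      (AnnulusRing.union p U.r₁ U.r₁) fun f => U.res₀plus_mem f.2)
    (((U.res₁plus p).comp (AnnulusRing.union p (q * U.r₀) U.r₁).val).codRestrict
      (AnnulusRing.union p U.r₁ U.r₁) fun f => U.res₁plus_mem f.2)
    (((U.res₀minus χ).comp (AnnulusRing.union p U.r₁ U.r₀).val).codRestrict
      (AnnulusRing.union p (q * U.r₀) (q * U.r₀)) fun f =>
        U.res₀minus_mem χ f.2)
    (((U.res₁minus p).comp (AnnulusRing.union p (q * U.r₀) U.r₁).val).codRestrict
      (AnnulusRing.union p (q * U.r₀) (q * U.r₀)) fun f => U.res₁minus_mem f.2))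

end StandardCover

end Tate

end PerfectoidTate

namespace PerfectoidTate

open Filter Topology CategoryTheory

universe u

/-! ### Homology of a complex concentrated in degrees 0 and 1 -/

section Homology

/-! The Čech differential is diagonal in the exponents: on coefficients of X^n it sends (f_n, g_n)
to (f_n - g_n, q^{-n} f_n - g_n), a 2×2 matrix of determinant q^{-n} - 1. Since |q| < 1, this is
nonzero unless n = 0, where kernel and cokernel are each one-dimensional: the constants in degree 0,
and the difference a_0 - b_0 of constant terms in degree 1.

What remains is convergence. For n ≠ 0 the unique solution of f_n - g_n = a_n, q^{-n} f_n - g_n =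
b_n is f_n = (a_n - b_n)/(1 - q^{-n}), g_n = f_n - a_n. The exponents in ℤ[1/p] accumulate at 0, so
q^{-n} may have norm arbitrarily close to 1; but the norm is ultrametric, hence |1 - q^{-n}| is
exactly max(1, |q|^{-n}) and no small denominators arise. This is what makes the bounds
`norm_quotient_mul_weight_le` and `norm_quotient_sub_mul_weight_le` hold with constant 1; through
`exists_cobounding` they give f on U₀ and g on U₁.

The solution at n involves only a_n and b_n, so it creates no new exponents and the argument also
works for the unions of finite levels. `cechDiff_cohomology` isolates the common linear algebra. The
statement on points compares norms with powers of |q|. -/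

theorem shortComplex_homology_iso {R : Type*} [Ring R] (S : ShortComplex (ModuleCat.{u} R))
    {M : Type u} [AddCommGroup M] [Module R M] (φ : S.X₂ →ₗ[R] M)
    (hsurj : ∀ m, ∃ x, S.g.hom x = 0 ∧ φ x = m)
    (hker : ∀ x, S.g.hom x = 0 → (φ x = 0 ↔ ∃ y, S.f.hom y = x)) :
    Nonempty (S.homology ≅ ModuleCat.of R M) := by
  -- Only the restriction of φ to cycles matters: its kernel is the boundaries, and the first
  -- isomorphism theorem applies.
  let ψ : LinearMap.ker S.g.hom →ₗ[R] M := φ ∘ₗ (LinearMap.ker S.g.hom).subtype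
  have hψ : Function.Surjective ψ := fun m => by
    obtain ⟨x, hx, hm⟩ := hsurj m
    exact ⟨⟨x, hx⟩, hm⟩
  have hψker : LinearMap.range S.moduleCatToCycles = LinearMap.ker ψ := by
    ext ⟨x, hx⟩
    rw [LinearMap.mem_ker, LinearMap.mem_range]
    refine Iff.trans ?_ (hker x hx).symm
    exact exists_congr fun y => Subtype.ext_iff
  exact ⟨S.moduleCatHomologyIso ≪≫ LinearEquiv.toModuleIso
    ((Submodule.quotEquivOfEq _ _ hψker).trans (ψ.quotKerEquivOfSurjective hψ))⟩

variable {K : Type u} [NormedField K] {A B M : Type u} [AddCommGroup A] [AddCommGroup B]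
  [AddCommGroup M] [Module K A] [Module K B] [Module K M] (d : A →ₗ[K] B)

theorem twoTerm_homology_zero (φ : A →ₗ[K] M) (hsurj : ∀ m, ∃ x, d x = 0 ∧ φ x = m)
    (hinj : ∀ x, d x = 0 → φ x = 0 → x = 0) :
    Nonempty ((twoTerm d).homology 0 ≅ ModuleCat.of K M) := by
  let e := HomologicalComplex.doubleXIso₀ (ModuleCat.ofHom d) (c := ComplexShape.up ℕ)
    (i₀ := 0) (i₁ := 1) rfl
  let e' := HomologicalComplex.doubleXIso₁ (ModuleCat.ofHom d) (c := ComplexShape.up ℕ)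
    (i₀ := 0) (i₁ := 1) rfl zero_ne_one
  have hd : (twoTerm d).d 0 1 = e.hom ≫ ModuleCat.ofHom d ≫ e'.inv :=
    HomologicalComplex.double_d _ _ zero_ne_one
  -- In `ComplexShape.up ℕ` the predecessor of 0 is by default 0 itself, so the short complex at
  -- degree 0 starts with this zero map.
  have h0 : (twoTerm d).d 0 0 = 0 := (twoTerm d).shape _ _ (by simp)
  have hmap : ∀ x, ((twoTerm d).d 0 1).hom x = 0 ↔ d (e.hom.hom x) = 0 := fun x => by
    rw [hd]
    exact map_eq_zero_iff _ e'.toLinearEquiv.symm.injective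
  obtain ⟨i⟩ := shortComplex_homology_iso ((twoTerm d).sc' 0 0 1) (φ ∘ₗ e.hom.hom)
    (fun m => by
      obtain ⟨x, hx, hm⟩ := hsurj m
      obtain ⟨y, rfl⟩ := e.toLinearEquiv.surjective x
      exact ⟨y, (hmap y).2 hx, hm⟩)
    (fun x hx => by
      have hx' := (hmap x).1 hx
      change φ (e.hom.hom x) = 0 ↔ ∃ y, ((twoTerm d).d 0 0).hom y = x
      rw [h0]
      constructor
      · intro h
        refine ⟨0, ?_⟩
        have := hinj _ hx' h
        exact ((map_eq_zero_iff _ e.toLinearEquiv.injective).1 this).symm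
      · rintro ⟨y, rfl⟩
        change φ (e.hom.hom 0) = 0
        rw [map_zero, map_zero])
  exact ⟨(twoTerm d).homologyIsoSc' 0 0 1 (by simp) (by simp) ≪≫ i⟩

/-- The hypotheses present M as the cokernel of d; everything in degree 1 is a cycle because degree
2 vanishes. -/
theorem twoTerm_homology_one (φ : B →ₗ[K] M) (hsurj : Function.Surjective φ)
    (hker : ∀ y, φ y = 0 ↔ ∃ x, d x = y) :
    Nonempty ((twoTerm d).homology 1 ≅ ModuleCat.of K M) := by
  let e := HomologicalComplex.doubleXIso₀ (ModuleCat.ofHom d) (c := ComplexShape.up ℕ)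
    (i₀ := 0) (i₁ := 1) rfl
  let e' := HomologicalComplex.doubleXIso₁ (ModuleCat.ofHom d) (c := ComplexShape.up ℕ)
    (i₀ := 0) (i₁ := 1) rfl zero_ne_one
  have hd : (twoTerm d).d 0 1 = e.hom ≫ ModuleCat.ofHom d ≫ e'.inv :=
    HomologicalComplex.double_d _ _ zero_ne_one
  have h0 : (twoTerm d).d 1 2 = 0 := HomologicalComplex.double_d_eq_zero₀ _ _ _ _ one_ne_zero
  obtain ⟨i⟩ := shortComplex_homology_iso ((twoTerm d).sc' 0 1 2) (φ ∘ₗ e'.hom.hom)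
    (fun m => by
      obtain ⟨x, hm⟩ := hsurj m
      obtain ⟨y, rfl⟩ := e'.toLinearEquiv.surjective x
      refine ⟨y, ?_, hm⟩
      change ((twoTerm d).d 1 2).hom y = 0
      rw [h0]
      rfl)
    (fun y _ => by
      change φ (e'.hom.hom y) = 0 ↔ ∃ x, ((twoTerm d).d 0 1).hom x = y
      rw [hker, hd]
      refine (e.toLinearEquiv.surjective.exists (p := fun x => d x = e'.hom.hom y)).trans ?_
      exact exists_congr fun x =>
        (e'.toLinearEquiv.symm_apply_eq (x := d (e.hom.hom x)) (y := y)).symm)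
  exact ⟨(twoTerm d).homologyIsoSc' 0 1 2 (by simp) (by simp) ≪≫ i⟩

theorem twoTerm_homology_isZero {i : ℕ} (hi : 2 ≤ i) :
    Limits.IsZero ((twoTerm d).homology i) := by
  refine ((twoTerm d).exactAt_iff_isZero_homology i).1 (ShortComplex.exact_of_isZero_X₂ _ ?_)
  exact HomologicalComplex.isZero_double_X (ModuleCat.ofHom d) (c := ComplexShape.up ℕ)
    (i₀ := 0) (i₁ := 1) rfl i (by omega) (by omega)

end Homology

/-! ### The cover on points of the Tate curve -/

section Points

variable {K : Type*} [NormedField K] {q : Kˣ}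

theorem tateCurve_eq_iff {x y : Kˣ} :
    (x : TateCurve q) = y ↔ ∃ k : ℤ, y = x * q ^ k := by
  rw [QuotientGroup.eq, Subgroup.mem_zpowers_iff]
  exact exists_congr fun k => by rw [eq_inv_mul_iff_mul_eq, eq_comm]

theorem norm_mul_zpow_le (hq : ‖(q : K)‖ < 1) (x : Kˣ) {j k : ℤ} (h : j ≤ k) :
    ‖((x * q ^ k : Kˣ) : K)‖ ≤ ‖(x : K)‖ * ‖(q : K)‖ ^ j := by
  rw [Units.val_mul, norm_mul, Units.val_zpow_eq_zpow_val, norm_zpow]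
  exact mul_le_mul_of_nonneg_left
    (zpow_le_zpow_right_of_le_one₀ (norm_units_pos q) hq.le h) (norm_nonneg _)

theorem norm_mul_zpow_ge (hq : ‖(q : K)‖ < 1) (x : Kˣ) {j k : ℤ} (h : k ≤ j) :
    ‖(x : K)‖ * ‖(q : K)‖ ^ j ≤ ‖((x * q ^ k : Kˣ) : K)‖ := by
  rw [Units.val_mul, norm_mul, Units.val_zpow_eq_zpow_val, norm_zpow]
  exact mul_le_mul_of_nonneg_left
    (zpow_le_zpow_right_of_le_one₀ (norm_units_pos q) hq.le h) (norm_nonneg _)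

/-- A nontrivial power of q changes the norm by a factor of at least |q|⁻¹ in one direction, which
exceeds the ratio |s₂|/|s₁| of the radii. -/
theorem injOn_annulus (hq : ‖(q : K)‖ < 1) {s₁ s₂ : Kˣ}
    (h : ‖((q * s₂ : Kˣ) : K)‖ < ‖(s₁ : K)‖) :
    Set.InjOn (fun x : Kˣ => (x : TateCurve q)) (annulus s₁ s₂) := by
  intro x hx y hy hxy
  obtain ⟨k, rfl⟩ := tateCurve_eq_iff.1 hxy
  rw [Units.val_mul, norm_mul] at h
  have hq0 := norm_units_pos q
  rcases lt_trichotomy k 0 with hk | rfl | hk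
  · have h1 := norm_mul_zpow_ge hq x (show k ≤ -1 by omega)
    rw [zpow_neg_one, ← div_eq_mul_inv, div_le_iff₀ hq0] at h1
    nlinarith [hx.1, hy.2]
  · simp
  · have h1 := norm_mul_zpow_le hq x (show 1 ≤ k by omega)
    rw [zpow_one] at h1
    nlinarith [hx.2, hy.1]

namespace StandardCover

variable (U : StandardCover q)

theorem image_union (hq : ‖(q : K)‖ < 1) :
    image q (annulus U.r₁ U.r₀) ∪ image q (annulus (q * U.r₀) U.r₁) = Set.univ := by
  refine Set.eq_univ_of_forall fun z => ?_
  obtain ⟨x, rfl⟩ := QuotientGroup.mk_surjective z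
  have hq0 := norm_units_pos q
  have hr := norm_units_pos U.r₀
  -- With |q|^{-n} < |x|/|r₀| ≤ |q|^{-(n+1)}, the translate x q^{n+1} has norm in (|q r₀|, |r₀|], an
  -- interval that |r₁| divides between the two annuli.
  obtain ⟨n, hn⟩ := exists_mem_Ioc_zpow (div_pos (norm_units_pos x) hr) ((one_lt_inv₀ hq0).2 hq)
  rw [Set.mem_Ioc, lt_div_iff₀ hr, div_le_iff₀ hr, inv_zpow', inv_zpow'] at hn
  have hy : ‖((x * q ^ (n + 1) : Kˣ) : K)‖ = ‖(x : K)‖ * ‖(q : K)‖ ^ (n + 1) := by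
    simp
  have hpos : 0 < ‖(q : K)‖ ^ (n + 1) := zpow_pos hq0 _
  have h1 : ‖((x * q ^ (n + 1) : Kˣ) : K)‖ ≤ ‖(U.r₀ : K)‖ := by
    rw [hy]
    calc _ ≤ ‖(q : K)‖ ^ (-(n + 1)) * ‖(U.r₀ : K)‖ * ‖(q : K)‖ ^ (n + 1) :=
          mul_le_mul_of_nonneg_right hn.2 hpos.le
      _ = _ := by
        rw [zpow_neg]
        field_simp
  have h2 : ‖((q * U.r₀ : Kˣ) : K)‖ ≤ ‖((x * q ^ (n + 1) : Kˣ) : K)‖ := by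
    rw [hy, Units.val_mul, norm_mul]
    calc ‖(q : K)‖ * ‖(U.r₀ : K)‖
        = ‖(q : K)‖ ^ (-n) * ‖(U.r₀ : K)‖ * ‖(q : K)‖ ^ (n + 1) := by
          rw [zpow_neg, zpow_add_one₀ hq0.ne']
          have := (zpow_pos hq0 n).ne'
          field_simp
      _ ≤ _ := mul_le_mul_of_nonneg_right hn.1.le hpos.le
  have hmk : ((x * q ^ (n + 1) : Kˣ) : TateCurve q) = x := (tateCurve_eq_iff.2 ⟨_, rfl⟩).symm
  rcases le_total ‖(U.r₁ : K)‖ ‖((x * q ^ (n + 1) : Kˣ) : K)‖ with h | h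
  · exact Or.inl ⟨_, ⟨h, h1⟩, hmk⟩
  · exact Or.inr ⟨_, ⟨h2, h⟩, hmk⟩

theorem image_outer_eq :
    image q (annulus U.r₀ U.r₀) = image q (annulus (q * U.r₀) (q * U.r₀)) := by
  have hq0 := norm_units_pos q
  have hmk : ∀ x : Kˣ, ((q * x : Kˣ) : TateCurve q) = x := fun x =>
    (tateCurve_eq_iff.2 ⟨1, by rw [zpow_one, mul_comm]⟩).symm
  ext z
  constructor
  · rintro ⟨x, hx, rfl⟩
    refine ⟨q * x, ?_, hmk x⟩
    simpa [annulus, hq0] using hx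
  · rintro ⟨x, hx, rfl⟩
    refine ⟨q⁻¹ * x, ?_, by simpa using (hmk (q⁻¹ * x)).symm⟩
    obtain ⟨y, rfl⟩ : ∃ y, x = q * y := ⟨q⁻¹ * x, by simp⟩
    simpa [annulus, hq0] using hx

/-- Let x ∈ U₀ and x q^k ∈ U₁. If k < 0, then |x q^k| > |r₁|, which is impossible; k = 0 forces |x|
= |r₁|; and k ≥ 1 gives |x q^k| ≤ |q r₀|, so x q^k is on the inner boundary of U₁. -/
theorem image_inter (hq : ‖(q : K)‖ < 1) :
    image q (annulus U.r₁ U.r₀) ∩ image q (annulus (q * U.r₀) U.r₁) =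
      image q (annulus U.r₁ U.r₁) ∪ image q (annulus (q * U.r₀) (q * U.r₀)) := by
  have hq0 := norm_units_pos q
  have hr₁ := norm_units_pos U.r₁
  apply Set.Subset.antisymm
  · rintro z ⟨⟨x, hx, rfl⟩, y, hy, hxy⟩
    obtain ⟨k, rfl⟩ := tateCurve_eq_iff.1 hxy.symm
    rcases lt_or_ge k 0 with hk | hk
    · have h1 := norm_mul_zpow_ge hq x (show k ≤ -1 by omega)
      rw [zpow_neg_one, ← div_eq_mul_inv, div_le_iff₀ hq0] at h1
      nlinarith [hx.1, hy.2]
    rcases eq_or_lt_of_le hk with rfl | hk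
    · refine Or.inl ⟨x, ⟨hx.1, ?_⟩, rfl⟩
      simpa using hy.2
    · refine Or.inr ⟨_, ⟨hy.1, ?_⟩, hxy⟩
      refine (norm_mul_zpow_le hq x (show 1 ≤ k by omega)).trans ?_
      rw [zpow_one, Units.val_mul, norm_mul, mul_comm]
      exact mul_le_mul_of_nonneg_left hx.2 hq0.le
  · rintro z (⟨x, hx, rfl⟩ | hz)
    · exact ⟨⟨x, ⟨hx.1, hx.2.trans U.lt_outer.le⟩, rfl⟩, x, ⟨U.inner_lt.le.trans hx.1, hx.2⟩, rfl⟩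
    · refine ⟨?_, ?_⟩
      · rw [← image_outer_eq] at hz
        obtain ⟨x, hx, rfl⟩ := hz
        exact ⟨x, ⟨U.lt_outer.le.trans hx.1, hx.2⟩, rfl⟩
      · obtain ⟨x, hx, rfl⟩ := hz
        exact ⟨x, ⟨hx.1, hx.2.trans U.inner_lt.le⟩, rfl⟩

/-- The value |q r₀| lies strictly between |q r₁| and |r₁|, and translating the circle of radius
|r₁| by q^k gives a norm ≥ |r₁| for k ≤ 0 and ≤ |q r₁| for k ≥ 1. -/
theorem disjoint_image (hq : ‖(q : K)‖ < 1) :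
    Disjoint (image q (annulus U.r₁ U.r₁)) (image q (annulus (q * U.r₀) (q * U.r₀))) := by
  rw [Set.disjoint_left]
  rintro z ⟨x, hx, rfl⟩ ⟨y, hy, hxy⟩
  obtain ⟨k, rfl⟩ := tateCurve_eq_iff.1 hxy.symm
  have hq0 := norm_units_pos q
  have h := U.inner_lt
  have h' := U.lt_outer
  rcases le_or_gt k 0 with hk | hk
  · have h1 := norm_mul_zpow_ge hq x hk
    rw [zpow_zero, mul_one] at h1
    linarith [hx.1, hy.2]
  · have h1 := norm_mul_zpow_le hq x (show 1 ≤ k by omega)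
    have h2 := hy.1
    rw [Units.val_mul, norm_mul] at h2
    rw [zpow_one] at h1
    nlinarith [hx.2]

end StandardCover

end Points

/-! ### Comparison of weights -/

section Weight

variable {p : ℕ}

theorem weight_le_weight_of_pos {ρ σ : ℝ} (hρ : 0 < ρ) (h : ρ ≤ σ) {n : Exps p}
    (hn : 0 < (n : ℚ)) : weight ρ n ≤ weight σ n :=
  Real.rpow_le_rpow hρ.le h (by exact_mod_cast hn.le)

theorem weight_le_weight_of_neg {ρ σ : ℝ} (hρ : 0 < ρ) (h : ρ ≤ σ) {n : Exps p}
    (hn : (n : ℚ) < 0) : weight σ n ≤ weight ρ n :=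
  Real.rpow_le_rpow_of_nonpos hρ h (by exact_mod_cast hn.le)

theorem one_lt_weight_neg {ρ : ℝ} (hρ : 0 < ρ) (h : ρ < 1) {n : Exps p}
    (hn : 0 < (n : ℚ)) : 1 < weight ρ (-n) :=
  Real.one_lt_rpow_of_pos_of_lt_one_of_neg hρ h (by
    rw [AddSubgroup.coe_neg]
    exact_mod_cast neg_lt_zero.2 hn)

theorem weight_neg_lt_one {ρ : ℝ} (hρ : 0 < ρ) (h : ρ < 1) {n : Exps p}
    (hn : (n : ℚ) < 0) : weight ρ (-n) < 1 :=
  Real.rpow_lt_one hρ.le h (by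
    rw [AddSubgroup.coe_neg]
    exact_mod_cast neg_pos.2 hn)

theorem weight_mul_weight_neg {ρ : ℝ} (hρ : 0 < ρ) (n : Exps p) :
    weight ρ n * weight ρ (-n) = 1 := by
  rw [← weight_add hρ, add_neg_cancel, weight_zero]

/-- The three radii are independent: convergence on one circle is to be deduced from data given on
two other circles. -/
theorem Conv.of_le {K : Type*} [NormedField K] {ρ σ τ : ℝ} (hρ : 0 < ρ) {f a b : Exps p → K}
    (ha : Conv σ a) (hb : Conv τ b)
    (h : ∀ n, ‖f n‖ * weight ρ n ≤ ‖a n‖ * weight σ n + ‖b n‖ * weight τ n) : Conv ρ f := by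
  have := Tendsto.add ha hb
  rw [add_zero] at this
  exact squeeze_zero (fun n => mul_nonneg (norm_nonneg _) (weight_pos hρ n).le) h this

end Weight

/-! ### Bounds for the solution, coefficient by coefficient -/

section Estimates

variable {p : ℕ} [Fact p.Prime] {K : Type*} [NormedField K] [IsUltrametricDist K] {q : Kˣ}
  (χ : PowerSystem p q)

theorem norm_one_sub_of_norm_lt_one {c : K} (hc : ‖c‖ < 1) : ‖1 - c‖ = 1 := by
  rw [sub_eq_add_neg, IsUltrametricDist.norm_add_eq_max_of_norm_ne_norm] <;>
    rw [norm_neg, norm_one]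
  · exact max_eq_left hc.le
  · exact hc.ne'

theorem norm_one_sub_of_one_lt_norm {c : K} (hc : 1 < ‖c‖) : ‖1 - c‖ = ‖c‖ := by
  rw [sub_eq_add_neg, IsUltrametricDist.norm_add_eq_max_of_norm_ne_norm] <;>
    rw [norm_neg, norm_one]
  · exact max_eq_right hc.le
  · exact hc.ne

namespace PowerSystem

/-- Here |q^{-n}| > 1, so this term dominates; for negative n the term 1 does. Either way the
denominator has norm at least 1, however close n is to 0. -/
theorem norm_one_sub_of_pos (hq : ‖(q : K)‖ < 1) {n : Exps p} (hn : 0 < (n : ℚ)) :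
    ‖1 - (χ.pow (Multiplicative.ofAdd (-n)) : K)‖ = weight ‖(q : K)‖ (-n) := by
  rw [norm_one_sub_of_one_lt_norm, χ.norm_pow]
  rw [χ.norm_pow]
  exact one_lt_weight_neg (norm_units_pos q) hq hn

theorem norm_one_sub_of_neg (hq : ‖(q : K)‖ < 1) {n : Exps p} (hn : (n : ℚ) < 0) :
    ‖1 - (χ.pow (Multiplicative.ofAdd (-n)) : K)‖ = 1 := by
  rw [norm_one_sub_of_norm_lt_one]
  rw [χ.norm_pow]
  exact weight_neg_lt_one (norm_units_pos q) hq hn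

theorem one_sub_ne_zero (hq : ‖(q : K)‖ < 1) {n : Exps p} (hn : n ≠ 0) :
    1 - (χ.pow (Multiplicative.ofAdd (-n)) : K) ≠ 0 := by
  have hn' : (n : ℚ) ≠ 0 := fun h => hn (Subtype.ext h)
  rw [← norm_ne_zero_iff]
  rcases hn'.lt_or_gt with h | h
  · rw [χ.norm_one_sub_of_neg hq h]
    exact one_ne_zero
  · rw [χ.norm_one_sub_of_pos hq h]
    exact (weight_pos (norm_units_pos q) _).ne'

/-- This controls f on U₀. For n < 0 the weight is largest on the inner circle |r₁|, and larger
still at |q r₀|. For n > 0 it is largest at |r₀|, and the denominator, of norm |q|^{-n}, lowers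
|r₀|^n to |q r₀|^n ≤ |r₁|^n. -/
theorem norm_quotient_mul_weight_le (hq : ‖(q : K)‖ < 1) {r₀ r₁ : Kˣ}
    (h₁ : ‖((q * r₀ : Kˣ) : K)‖ ≤ ‖(r₁ : K)‖) {ρ : ℝ} (hρ₁ : ‖(r₁ : K)‖ ≤ ρ)
    (hρ₀ : ρ ≤ ‖(r₀ : K)‖) (x y : K) (n : Exps p) :
    ‖(x - y) / (1 - (χ.pow (Multiplicative.ofAdd (-n)) : K))‖ * weight ρ n ≤
      ‖x‖ * weight ‖(r₁ : K)‖ n + ‖y‖ * weight ‖((q * r₀ : Kˣ) : K)‖ n := by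
  have hq0 := norm_units_pos q
  have hr₀ := norm_units_pos r₀
  have hr₁ := norm_units_pos r₁
  have hqr := norm_units_pos (q * r₀)
  have hρ := hr₁.trans_le hρ₁
  have hw₁ := weight_pos hr₁ n
  have hwq := weight_pos hqr n
  have hwρ := weight_pos hρ n
  have hxy := norm_sub_le x y
  rcases lt_trichotomy (n : ℚ) 0 with hn | hn | hn
  · rw [norm_div, χ.norm_one_sub_of_neg hq hn, div_one]
    have k₁ := weight_le_weight_of_neg hr₁ hρ₁ hn
    have k₂ := weight_le_weight_of_neg hqr h₁ hn
    calc _ ≤ (‖x‖ + ‖y‖) * weight ‖(r₁ : K)‖ n := by gcongr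
      _ = ‖x‖ * weight ‖(r₁ : K)‖ n + ‖y‖ * weight ‖(r₁ : K)‖ n := add_mul _ _ _
      _ ≤ _ := by gcongr
  -- At n = 0 the denominator is 0 and the quotient is 0 by convention.
  · obtain rfl : n = 0 := Subtype.ext hn
    simp only [neg_zero, ofAdd_zero, map_one, Units.val_one, sub_self, div_zero, norm_zero,
      zero_mul]
    positivity
  · have hc := weight_pos hq0 (-n)
    rw [norm_div, χ.norm_one_sub_of_pos hq hn, div_mul_eq_mul_div, div_le_iff₀ hc]
    have k₁ := weight_le_weight_of_pos hρ hρ₀ hn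
    have k₂ := weight_le_weight_of_pos hqr h₁ hn
    have k₃ : weight ‖(r₀ : K)‖ n =
        weight ‖((q * r₀ : Kˣ) : K)‖ n * weight ‖(q : K)‖ (-n) := by
      rw [Units.val_mul, norm_mul, weight_mul hq0 hr₀]
      linear_combination -weight ‖(r₀ : K)‖ n * weight_mul_weight_neg hq0 n
    calc _ ≤ (‖x‖ + ‖y‖) * weight ‖(r₀ : K)‖ n := by gcongr
      _ = (‖x‖ * weight ‖((q * r₀ : Kˣ) : K)‖ n + ‖y‖ * weight ‖((q * r₀ : Kˣ) : K)‖ n) *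
          weight ‖(q : K)‖ (-n) := by
        rw [k₃]
        ring
      _ ≤ _ := by gcongr

/-- This controls g = f - a on U₁. Bounding f and a separately fails: for n < 0 nothing bounds |a_n|
|q r₀|^n. After cancellation a_n carries the factor q^{-n}, and |q|^{-n} |q r₀|^n = |r₀|^n ≤ |r₁|^n.
-/
theorem norm_quotient_sub_mul_weight_le (hq : ‖(q : K)‖ < 1) {r₀ r₁ : Kˣ}
    (h₀ : ‖(r₁ : K)‖ ≤ ‖(r₀ : K)‖) {ρ : ℝ} (hρ₀ : ‖((q * r₀ : Kˣ) : K)‖ ≤ ρ)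
    (hρ₁ : ρ ≤ ‖(r₁ : K)‖) (x y : K) (n : Exps p) :
    ‖(x - y) / (1 - (χ.pow (Multiplicative.ofAdd (-n)) : K)) - x‖ * weight ρ n ≤
      ‖x‖ * weight ‖(r₁ : K)‖ n + ‖y‖ * weight ‖((q * r₀ : Kˣ) : K)‖ n := by
  have hq0 := norm_units_pos q
  have hr₀ := norm_units_pos r₀
  have hr₁ := norm_units_pos r₁
  have hqr := norm_units_pos (q * r₀)
  have hρ := hqr.trans_le hρ₀
  have hw₁ := weight_pos hr₁ n
  have hwq := weight_pos hqr n
  have hwρ := weight_pos hρ n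
  have hc := weight_pos hq0 (-n)
  have k₃ : weight ‖(r₀ : K)‖ n =
      weight ‖((q * r₀ : Kˣ) : K)‖ n * weight ‖(q : K)‖ (-n) := by
    rw [Units.val_mul, norm_mul, weight_mul hq0 hr₀]
    linear_combination -weight ‖(r₀ : K)‖ n * weight_mul_weight_neg hq0 n
  rcases eq_or_ne n 0 with rfl | hn0
  · simp only [neg_zero, ofAdd_zero, map_one, Units.val_one, sub_self, div_zero, zero_sub,
      norm_neg, weight_zero, mul_one]
    exact le_add_of_nonneg_right (norm_nonneg y)
  have heq : (x - y) / (1 - (χ.pow (Multiplicative.ofAdd (-n)) : K)) - x =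
      (χ.pow (Multiplicative.ofAdd (-n)) * x - y) /
        (1 - (χ.pow (Multiplicative.ofAdd (-n)) : K)) := by
    have := χ.one_sub_ne_zero hq hn0
    field_simp
    ring
  have hxy := norm_sub_le ((χ.pow (Multiplicative.ofAdd (-n)) : K) * x) y
  rw [norm_mul, χ.norm_pow] at hxy
  rw [heq, norm_div]
  rcases lt_or_gt_of_ne (show (n : ℚ) ≠ 0 from fun h => hn0 (Subtype.ext h)) with hn | hn
  · rw [χ.norm_one_sub_of_neg hq hn, div_one]
    have k₁ := weight_le_weight_of_neg hqr hρ₀ hn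
    have k₂ := weight_le_weight_of_neg hr₁ h₀ hn
    calc _ ≤ (weight ‖(q : K)‖ (-n) * ‖x‖ + ‖y‖) * weight ‖((q * r₀ : Kˣ) : K)‖ n := by gcongr
      _ = ‖x‖ * weight ‖(r₀ : K)‖ n + ‖y‖ * weight ‖((q * r₀ : Kˣ) : K)‖ n := by
        rw [k₃]
        ring
      _ ≤ _ := by gcongr
  · rw [χ.norm_one_sub_of_pos hq hn, div_mul_eq_mul_div, div_le_iff₀ hc]
    have k₁ := weight_le_weight_of_pos hρ hρ₁ hn
    have k₂ := weight_le_weight_of_pos hr₁ h₀ hn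
    calc _ ≤ (weight ‖(q : K)‖ (-n) * ‖x‖ + ‖y‖) * weight ‖(r₁ : K)‖ n := by gcongr
      _ = ‖x‖ * weight ‖(r₁ : K)‖ n * weight ‖(q : K)‖ (-n) + ‖y‖ * weight ‖(r₁ : K)‖ n := by
        ring
      _ ≤ ‖x‖ * weight ‖(r₁ : K)‖ n * weight ‖(q : K)‖ (-n) + ‖y‖ * weight ‖(r₀ : K)‖ n := by
        gcongr
      _ = _ := by
        rw [k₃]
        ring

end PowerSystem

end Estimates

/-! ### Solving the coboundary equation and computing cohomology -/

section Cohomology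

theorem AnnulusRing.coeff_one_zero {p : ℕ} {K : Type*} [NormedField K] [IsUltrametricDist K]
    (r₁ r₂ : Kˣ) :
    coeff (1 : AnnulusRing p r₁ r₂) 0 = 1 := by
  classical
  rw [coeff_one, Pi.single_eq_same]

variable {p : ℕ} [Fact p.Prime] {K : Type u} [NormedField K] [IsUltrametricDist K]
  {q : Kˣ} (χ : PowerSystem p q)

/-- A pair of series on the boundary circles whose constant terms agree is a coboundary, of series
with no exponents other than those of the pair. -/
theorem StandardCover.exists_cobounding [CompleteSpace K] (U : StandardCover q)
    (hq : ‖(q : K)‖ < 1) (a : U.Oplus p) (b : U.Ominus p)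
    (hab : AnnulusRing.coeff a 0 = AnnulusRing.coeff b 0) :
    ∃ (f : U.O₀ p) (g : U.O₁ p),
      (∀ n, AnnulusRing.coeff f n - AnnulusRing.coeff g n = AnnulusRing.coeff a n) ∧
      (∀ n, (χ.pow (Multiplicative.ofAdd (-n)) : K) * AnnulusRing.coeff f n -
        AnnulusRing.coeff g n = AnnulusRing.coeff b n) ∧
      ∀ n, AnnulusRing.coeff a n = 0 → AnnulusRing.coeff b n = 0 →
        AnnulusRing.coeff f n = 0 ∧ AnnulusRing.coeff g n = 0 := by
  have h₁ := U.inner_lt.le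
  have h₀ := U.lt_outer.le
  have key := fun ρ => χ.norm_quotient_mul_weight_le hq h₁ (ρ := ρ)
  have key' := fun ρ => χ.norm_quotient_sub_mul_weight_le hq h₀ (ρ := ρ)
  -- Subtracting the two equations eliminates g and leaves (1 - q^{-n}) f_n = a_n - b_n. Division by
  -- zero sets `F 0 = 0`, so g_0 = -a_0, and the second equation at n = 0 becomes the hypothesis a_0
  -- = b_0.
  let F : Exps p → K := fun n => (AnnulusRing.coeff a n - AnnulusRing.coeff b n) /
    (1 - (χ.pow (Multiplicative.ofAdd (-n)) : K))
  refine ⟨AnnulusRing.mk F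
      (.of_le (norm_units_pos _) a.conv₁ b.conv₁ fun n => key _ le_rfl h₀ _ _ n)
      (.of_le (norm_units_pos _) a.conv₁ b.conv₁ fun n => key _ h₀ le_rfl _ _ n),
    AnnulusRing.mk (fun n => F n - AnnulusRing.coeff a n)
      (.of_le (norm_units_pos _) a.conv₁ b.conv₁ fun n => key' _ le_rfl h₁ _ _ n)
      (.of_le (norm_units_pos _) a.conv₁ b.conv₁ fun n => key' _ h₁ le_rfl _ _ n),
    fun n => ?_, fun n => ?_, fun n ha hb => ?_⟩
  · simp
  · simp only [AnnulusRing.coeff_mk, F]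
    rcases eq_or_ne n 0 with rfl | hn
    · simpa using hab
    · have := χ.one_sub_ne_zero hq hn
      field_simp
      ring
  · simp [F, ha, hb]

/-- The cohomology of a Čech complex of rings of series `∑ a_n X^n`, `n ∈ ℤ[1/p]`, glued by
`X ↦ X / q`, in which every pair of series with equal constant terms is a coboundary. -/
theorem cechDiff_cohomology (hq : ‖(q : K)‖ < 1) {A₀ A₁ Bp Bm : Type u} [CommRing A₀]
    [CommRing A₁] [CommRing Bp] [CommRing Bm] [Algebra K A₀] [Algebra K A₁] [Algebra K Bp]
    [Algebra K Bm] {f₀p : A₀ →ₐ[K] Bp} {f₁p : A₁ →ₐ[K] Bp} {f₀m : A₀ →ₐ[K] Bm}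
    {f₁m : A₁ →ₐ[K] Bm} (c₀ : A₀ →ₗ[K] Exps p → K) (c₁ : A₁ →ₗ[K] Exps p → K)
    (cp : Bp →ₗ[K] Exps p → K) (cm : Bm →ₗ[K] Exps p → K)
    (hc₀ : Function.Injective c₀) (hc₁ : Function.Injective c₁)
    (hcp : Function.Injective cp) (hcm : Function.Injective cm)
    (h₀p : ∀ f n, cp (f₀p f) n = c₀ f n) (h₁p : ∀ g n, cp (f₁p g) n = c₁ g n)
    (h₀m : ∀ f n, cm (f₀m f) n = (χ.pow (Multiplicative.ofAdd (-n)) : K) * c₀ f n)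
    (h₁m : ∀ g n, cm (f₁m g) n = c₁ g n) (hone : c₀ 1 0 = 1)
    (hsolve : ∀ a b, cp a 0 = cm b 0 → ∃ f g, (∀ n, c₀ f n - c₁ g n = cp a n) ∧
      ∀ n, (χ.pow (Multiplicative.ofAdd (-n)) : K) * c₀ f n - c₁ g n = cm b n) :
    Nonempty ((twoTerm (cechDiff f₀p f₁p f₀m f₁m)).homology 0 ≅ ModuleCat.of K K) ∧
      Nonempty ((twoTerm (cechDiff f₀p f₁p f₀m f₁m)).homology 1 ≅ ModuleCat.of K K) ∧
      ∀ i : ℕ, 2 ≤ i →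
        Limits.IsZero ((twoTerm (cechDiff f₀p f₁p f₀m f₁m)).homology i) := by
  have hd : ∀ f g a b, cechDiff f₀p f₁p f₀m f₁m (f, g) = (a, b) ↔
      (∀ n, c₀ f n - c₁ g n = cp a n) ∧
      ∀ n, (χ.pow (Multiplicative.ofAdd (-n)) : K) * c₀ f n - c₁ g n = cm b n := by
    intro f g a b
    have : cechDiff f₀p f₁p f₀m f₁m (f, g) = (f₀p f - f₁p g, f₀m f - f₁m g) := rfl
    rw [this, Prod.mk.injEq, ← hcp.eq_iff, ← hcm.eq_iff, funext_iff, funext_iff]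
    simp only [map_sub, Pi.sub_apply, h₀p, h₁p, h₀m, h₁m]
  -- The isomorphisms with K are induced by f_0 in degree 0 and by a_0 - b_0 in degree 1.
  refine ⟨twoTerm_homology_zero _ (LinearMap.proj 0 ∘ₗ c₀ ∘ₗ LinearMap.fst K A₀ A₁) ?_ ?_,
    twoTerm_homology_one _ (LinearMap.proj 0 ∘ₗ cp ∘ₗ LinearMap.fst K Bp Bm -
      LinearMap.proj 0 ∘ₗ cm ∘ₗ LinearMap.snd K Bp Bm) ?_ ?_,
    fun i hi => twoTerm_homology_isZero _ hi⟩
  · intro m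
    refine ⟨m • (1, 1), ?_, ?_⟩
    · have : cechDiff f₀p f₁p f₀m f₁m (1, 1) = 0 := by
        change (f₀p 1 - f₁p 1, f₀m 1 - f₁m 1) = 0
        simp
      rw [map_smul, this, smul_zero]
    · simp [hone]
  · rintro ⟨f, g⟩ hfg h
    obtain ⟨h₁, h₂⟩ := (hd f g 0 0).1 hfg
    simp only [map_zero, Pi.zero_apply, sub_eq_zero] at h₁ h₂
    -- On a cocycle g_n = f_n = q^{-n} f_n, so f_n = 0 for n ≠ 0; the constant term vanishes by
    -- assumption.
    have hf : f = 0 := by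
      refine hc₀ ?_
      rw [map_zero]
      funext n
      rcases eq_or_ne n 0 with rfl | hn
      · exact h
      · refine (mul_eq_zero.1 ?_).resolve_left (χ.one_sub_ne_zero hq hn)
        rw [sub_mul, one_mul, h₂, h₁, sub_self]
    subst hf
    have hg : g = 0 := hc₁ (by
      funext n
      rw [← h₁, map_zero, map_zero])
    rw [hg]
    rfl
  · intro m
    refine ⟨(m • f₀p 1, 0), ?_⟩
    simp only [LinearMap.sub_apply, LinearMap.comp_apply, LinearMap.fst_apply,
      LinearMap.snd_apply, LinearMap.proj_apply, map_smul, map_zero, h₀p, hone, smul_eq_mul,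
      mul_one, sub_zero]
  · rintro ⟨a, b⟩
    change cp a 0 - cm b 0 = 0 ↔ _
    rw [sub_eq_zero]
    constructor
    · intro h
      obtain ⟨f, g, hfg⟩ := hsolve a b h
      exact ⟨(f, g), (hd f g a b).2 hfg⟩
    · rintro ⟨⟨f, g⟩, hfg⟩
      obtain ⟨h₁, h₂⟩ := (hd f g a b).1 hfg
      rw [← h₁, ← h₂]
      simp

variable [CompleteSpace K]

theorem StandardCover.cech_cohomology (U : StandardCover q) (hq : ‖(q : K)‖ < 1) :
    Nonempty ((U.cech χ).homology 0 ≅ ModuleCat.of K K) ∧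
      Nonempty ((U.cech χ).homology 1 ≅ ModuleCat.of K K) ∧
      ∀ i : ℕ, 2 ≤ i → Limits.IsZero ((U.cech χ).homology i) := by
  refine cechDiff_cohomology χ hq AnnulusRing.coeff AnnulusRing.coeff AnnulusRing.coeff
    AnnulusRing.coeff AnnulusRing.coeff_injective AnnulusRing.coeff_injective
    AnnulusRing.coeff_injective AnnulusRing.coeff_injective (fun _ _ => rfl) (fun _ _ => rfl)
    (fun _ _ => rfl) (fun _ _ => rfl) (AnnulusRing.coeff_one_zero _ _) fun a b hab => ?_
  obtain ⟨f, g, h₁, h₂, -⟩ := U.exists_cobounding χ hq a b hab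
  exact ⟨f, g, h₁, h₂⟩

theorem StandardCover.cechUnion_cohomology (U : StandardCover q) (hq : ‖(q : K)‖ < 1) :
    Nonempty ((U.cechUnion χ).homology 0 ≅ ModuleCat.of K K) ∧
      Nonempty ((U.cechUnion χ).homology 1 ≅ ModuleCat.of K K) ∧
      ∀ i : ℕ, 2 ≤ i → Limits.IsZero ((U.cechUnion χ).homology i) := by
  have hinj : ∀ r₁ r₂ : Kˣ, Function.Injective
      (AnnulusRing.coeff ∘ₗ (AnnulusRing.union p r₁ r₂).val.toLinearMap) :=
    fun _ _ => AnnulusRing.coeff_injective.comp Subtype.val_injective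
  refine cechDiff_cohomology χ hq _ _ _ _ (hinj _ _) (hinj _ _) (hinj _ _) (hinj _ _)
    (fun _ _ => rfl) (fun _ _ => rfl) (fun _ _ => rfl) (fun _ _ => rfl)
    ((congrArg (fun f => AnnulusRing.coeff f 0)
      (map_one (AnnulusRing.union p U.r₁ U.r₀).val)).trans (AnnulusRing.coeff_one_zero _ _)) ?_
  rintro ⟨a, i, ha⟩ ⟨b, j, hb⟩ hab
  obtain ⟨f, g, h₁, h₂, h₃⟩ := U.exists_cobounding χ hq a b hab
  -- Both a and b have exponents in the larger of their two levels, and the solution acquires no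
  -- others.
  have hsupp : ∀ n : Exps p, (n : ℚ) ∉ expLevel p (max i j) →
      AnnulusRing.coeff f n = 0 ∧ AnnulusRing.coeff g n = 0 := fun n hn =>
    h₃ n (by_contra fun h => hn (expLevel_mono p (le_max_left i j) (ha n h)))
      (by_contra fun h => hn (expLevel_mono p (le_max_right i j) (hb n h)))
  exact ⟨⟨f, max i j, fun n => not_imp_comm.1 fun hn => (hsupp n hn).1⟩,
    ⟨g, max i j, fun n => not_imp_comm.1 fun hn => (hsupp n hn).2⟩, h₁, h₂⟩

end Cohomology

end PerfectoidTate

theorem mainTheorem3 {p : ℕ} [Fact p.Prime] {K : Type*} [NormedField K] [IsUltrametricDist K]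
    [CompleteSpace K] (hK : PerfectoidTate.IsPerfectoidField p K)
    (q : Kˣ) (hq : ‖(q : K)‖ < 1) (χ : PerfectoidTate.PowerSystem p q)
    (U : PerfectoidTate.StandardCover q) :
    -- the two annuli embed in the Tate curve, cover it, and meet in the two boundary circles
    (Set.InjOn (fun x : Kˣ => (x : PerfectoidTate.TateCurve q))
        (PerfectoidTate.annulus U.r₁ U.r₀) ∧
      Set.InjOn (fun x : Kˣ => (x : PerfectoidTate.TateCurve q))
        (PerfectoidTate.annulus (q * U.r₀) U.r₁) ∧
      PerfectoidTate.image q (PerfectoidTate.annulus U.r₁ U.r₀) ∪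
        PerfectoidTate.image q (PerfectoidTate.annulus (q * U.r₀) U.r₁) = Set.univ ∧
      PerfectoidTate.image q (PerfectoidTate.annulus U.r₁ U.r₀) ∩
          PerfectoidTate.image q (PerfectoidTate.annulus (q * U.r₀) U.r₁) =
        PerfectoidTate.image q (PerfectoidTate.annulus U.r₁ U.r₁) ∪
          PerfectoidTate.image q (PerfectoidTate.annulus (q * U.r₀) (q * U.r₀)) ∧
      Disjoint (PerfectoidTate.image q (PerfectoidTate.annulus U.r₁ U.r₁))
        (PerfectoidTate.image q (PerfectoidTate.annulus (q * U.r₀) (q * U.r₀))) ∧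
      PerfectoidTate.image q (PerfectoidTate.annulus U.r₀ U.r₀) =
        PerfectoidTate.image q (PerfectoidTate.annulus (q * U.r₀) (q * U.r₀))) ∧
    -- cohomology, for the complete rings
    (Nonempty ((U.cech χ).homology 0 ≅ ModuleCat.of K K) ∧
      Nonempty ((U.cech χ).homology 1 ≅ ModuleCat.of K K) ∧
      ∀ i : ℕ, 2 ≤ i → CategoryTheory.Limits.IsZero ((U.cech χ).homology i)) ∧
    -- cohomology, for the unions of the rings at finite level
    (Nonempty ((U.cechUnion χ).homology 0 ≅ ModuleCat.of K K) ∧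
      Nonempty ((U.cechUnion χ).homology 1 ≅ ModuleCat.of K K) ∧
      ∀ i : ℕ, 2 ≤ i → CategoryTheory.Limits.IsZero ((U.cechUnion χ).homology i)) := by
  exact ⟨⟨PerfectoidTate.injOn_annulus hq U.inner_lt,
      -- For U₁ the condition on the radii reads |q r₁| < |q r₀|.
      PerfectoidTate.injOn_annulus hq (by
        rw [Units.val_mul, Units.val_mul, norm_mul, norm_mul]
        exact mul_lt_mul_of_pos_left U.lt_outer (PerfectoidTate.norm_units_pos q)),
      U.image_union hq, U.image_inter hq, U.disjoint_image hq, U.image_outer_eq⟩,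
    U.cech_cohomology χ hq, U.cechUnion_cohomology χ hq⟩
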